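/- Let $n\ge 0$ be an integer, let $\varepsilon_1,\dots,\varepsilon_n$ be the standard orthonormal basis of $\mathbb R^n$, and let $$\Delta(\mathrm{BC}_n)=\{\pm\varepsilon_i\pm\varepsilon_j\ (1\le i<j\le n),\ \pm\varepsilon_i,\ \pm2\varepsilon_i\ (1\le i\le n)\}.$$ Let $\Pi\subset\Delta(\mathrm{BC}_n)$ be any set of simple roots, i.e. a linearly independent subset such that every root is a nonnegative or a nonpositive integral combination of elements of $\Pi$, and let $\Delta^+$ be the corresponding set of positive roots (the roots that are nonnegative integral combinations of $\Pi$). Order $\Delta^+$ by the standard root order, in which $\gamma$ covers $\mu$ if and only if $\gamma-\mu\in\Pi$ (that is, the reflexive transitive closure of this relation). Let $\mathrm{Ad}(\mathrm{BC}_n)$ be the lattice of upper ideals of $\Delta^+$ (subsets $I\subseteq\Delta^+$ such that $\mu\in I$ and $\mu\preccurlyeq\gamma$ imply $\gamma\in I$), ordered by inclusion. For a finite poset $P$ and $x\in P$, let $\kappa(x)$ be the number of elements covered by $x$ and $\iota(x)$ the number of elements covering $x$; the upper and lower covering polynomials of $P$ are $\sum_{x\in P}q^{\kappa(x)}$ and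 $\sum_{x\in P}q^{\iota(x)}$. Then the upper and the lower covering polynomials of $\mathrm{Ad}(\mathrm{BC}_n)$ are both equal to $$\sum_{k\ge0}\binom nk\binom{n+1}k q^k .$$ Consequently, the number of edges of the Hasse diagram of $\mathrm{Ad}(\mathrm{BC}_n)$, i.e. of pairs $(x,y)$ such that $x$ covers $y$, equals $$(n+1)\binom{2n}{n+1}=n\binom{2n}{n}.$$ -/

import Mathlib

open Polynomial

noncomputable section

/-! ### Covering polynomials of a finite poset -/

/-- The number `κ(x)` of elements covered by `x`. -/
def kappa {P : Type*} [PartialOrder P] (x : P) : ℕ := Set.ncard {y : P | y ⋖ x}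

/-- The number `ι(x)` of elements covering `x`. -/
def iota {P : Type*} [PartialOrder P] (x : P) : ℕ := Set.ncard {y : P | x ⋖ y}

/-- The upper covering polynomial `∑ x, q ^ κ(x)` of a finite poset. -/
def upperCoveringPolynomial (P : Type*) [PartialOrder P] [Finite P] : ℤ[X] :=
  letI := Fintype.ofFinite P
  ∑ x : P, X ^ kappa x

/-- The lower covering polynomial `∑ x, q ^ ι(x)` of a finite poset. -/
def lowerCoveringPolynomial (P : Type*) [PartialOrder P] [Finite P] : ℤ[X] :=
  letI := Fintype.ofFinite P
  ∑ x : P, X ^ iota x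

/-- The edges of the Hasse diagram: pairs `(x, y)` such that `x` covers `y`. -/
def hasseEdges (P : Type*) [PartialOrder P] : Set (P × P) := {e | e.2 ⋖ e.1}

/-- The distributive lattice of upper ideals of `L`, ordered by inclusion.
(Mathlib orders `UpperSet L` by reverse inclusion, hence the order dual.) -/
abbrev UpperIdeals (L : Type*) [PartialOrder L] : Type _ := (UpperSet L)ᵒᵈ

/-- The order on `UpperIdeals L` is inclusion. -/
theorem UpperIdeals.le_iff {L : Type*} [PartialOrder L] (I J : UpperIdeals L) :
    I ≤ J ↔ ((OrderDual.ofDual I : UpperSet L) : Set L) ⊆ ((OrderDual.ofDual J : UpperSet L) : Set L) :=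
  Iff.rfl

instance UpperIdeals.instFinite (L : Type*) [PartialOrder L] [Finite L] :
    Finite (UpperIdeals L) :=
  Finite.of_injective (fun I : UpperIdeals L => ((OrderDual.ofDual I : UpperSet L) : Set L))
    (fun _ _ h => OrderDual.ofDual.injective (SetLike.coe_injective h))

/-! ### Simple roots, positive roots and the root order -/

/-- A set of simple roots (a base) of a root system `Δ` in a real vector space: a linearly
independent subset of `Δ` such that each root is a nonnegative or a nonpositive integral
combination of its elements. -/
structure SimpleSystem {V : Type*} [AddCommGroup V] [Module ℝ V] (Δ : Set V) where
  simple : Set V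
  simple_subset : simple ⊆ Δ
  linearIndepOn : LinearIndepOn ℝ id simple
  mem_or_neg_mem : ∀ γ ∈ Δ,
    γ ∈ AddSubmonoid.closure simple ∨ -γ ∈ AddSubmonoid.closure simple

/-- The positive roots `Δ⁺` determined by a set of simple roots. -/
def PosRoot {V : Type*} [AddCommGroup V] [Module ℝ V] {Δ : Set V} (S : SimpleSystem Δ) : Type _ :=
  {γ : V // γ ∈ Δ ∧ γ ∈ AddSubmonoid.closure S.simple}

namespace PosRoot

variable {V : Type*} [AddCommGroup V] [Module ℝ V] {Δ : Set V} {S : SimpleSystem Δ}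

/-- `Step μ γ` says that `γ - μ` is a simple root. -/
def Step (μ γ : PosRoot S) : Prop := γ.1 - μ.1 ∈ S.simple

theorem exists_height (S : SimpleSystem Δ) :
    ∃ f : V →ₗ[ℝ] ℝ, ∀ a ∈ S.simple, f a = 1 := by
  have hli : LinearIndependent ℝ ((↑) : S.simple → V) := S.linearIndepOn
  let B := Module.Basis.extend hli
  refine ⟨B.constr ℝ (fun _ => (1 : ℝ)), fun a ha => ?_⟩
  have h := B.constr_basis ℝ (fun _ => (1 : ℝ))
    ⟨a, S.linearIndepOn.subset_extend (Set.subset_univ _) ha⟩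
  rwa [show B _ = a from Module.Basis.extend_apply_self hli _] at h

/-- The standard root order: the reflexive transitive closure of the relation
"`γ - μ` is a simple root". -/
instance instPartialOrder : PartialOrder (PosRoot S) where
  le := Relation.ReflTransGen Step
  le_refl _ := Relation.ReflTransGen.refl
  le_trans _ _ _ := Relation.ReflTransGen.trans
  le_antisymm a b hab hba := by
    obtain ⟨f, hf⟩ := exists_height S
    have step : ∀ {x y : PosRoot S}, Step x y → f y.1 = f x.1 + 1 := fun {x y} h => by
      have := hf _ h
      rw [map_sub] at this
      linarith
    have mono : ∀ {x y : PosRoot S}, Relation.ReflTransGen Step x y → f x.1 ≤ f y.1 := by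
      intro x y h
      induction h with
      | refl => exact le_rfl
      | tail _ h ih => linarith [step h]
    rcases Relation.ReflTransGen.cases_head hab with h | ⟨c, hac, hcb⟩
    · exact h
    · linarith [step hac, mono hcb, mono hba]

instance instFinite [Finite Δ] : Finite (PosRoot S) :=
  Finite.of_injective (fun γ : PosRoot S => (⟨γ.1, γ.2.1⟩ : Δ))
    (fun _ _ h => Subtype.ext (Subtype.mk.inj h))

end PosRoot

/-! ### The root system of type `BC n` -/

/-- The standard orthonormal basis `ε 1, …, ε n` of Euclidean `n`-space. -/
abbrev eps {n : ℕ} (i : Fin n) : EuclideanSpace ℝ (Fin n) := EuclideanSpace.single i 1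

/-- The root system `BC n`: the vectors `± ε i ± ε j` with `i < j`, `± ε i`, and `± 2 ε i`. -/
def rootsBC (n : ℕ) : Set (EuclideanSpace ℝ (Fin n)) :=
  {v | (∃ i j : Fin n, i < j ∧
        (v = eps i + eps j ∨ v = eps i - eps j ∨ v = -eps i + eps j ∨ v = -eps i - eps j)) ∨
      (∃ i : Fin n, v = eps i ∨ v = -eps i) ∨
      (∃ i : Fin n, v = (2 : ℝ) • eps i ∨ v = -((2 : ℝ) • eps i))}

instance rootsBC.instFinite (n : ℕ) : Finite (rootsBC n) := by
  have h : rootsBC n ⊆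
      (⋃ i : Fin n, ⋃ j : Fin n,
        {eps i + eps j, eps i - eps j, -eps i + eps j, -eps i - eps j}) ∪
      (⋃ i : Fin n, {eps i, -eps i, (2 : ℝ) • eps i, -((2 : ℝ) • eps i)}) := by
    rintro v (⟨i, j, -, h⟩ | ⟨i, h⟩ | ⟨i, h⟩)
    · exact Or.inl (Set.mem_iUnion.2 ⟨i, Set.mem_iUnion.2 ⟨j, by simpa using h⟩⟩)
    · refine Or.inr (Set.mem_iUnion.2 ⟨i, ?_⟩)
      rcases h with h | h <;> simp [h]
    · refine Or.inr (Set.mem_iUnion.2 ⟨i, ?_⟩)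
      rcases h with h | h <;> simp [h]
  refine Set.Finite.subset (Set.Finite.union ?_ ?_) h
  · exact Set.finite_iUnion fun i => Set.finite_iUnion fun j => by simp
  · exact Set.finite_iUnion fun i => by simp

end

/-! In a finite poset, passing to a covered upper ideal deletes one minimal element, and passing to
a covering ideal adjoins one maximal non-member. An upper ideal is determined by either of these
antichains, so both covering polynomials equal the generating polynomial of antichains by size
(`upperCoveringPolynomial_upperIdeals`, `lowerCoveringPolynomial_upperIdeals`).

For `BC n`, list the signed basis vectors by decreasing height, then `0`, then their negatives in
reverse, as `E 0, …, E (2 * n)`. Oddness gives `E x - E y = E (2n - y) - E (2n - x)`, so each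
positive root is `E x - E y` for a unique pair with `x < y` and `x + y ≤ 2n`. Simple roots are
consecutive differences, and going up lowers `x` or raises `y` (`exists_posRoot_equiv_triangle`).
Antichains thus become chains strict in both coordinates inside a triangle. Such chains are counted
by their top point: the points strictly below it form a trapezoid, whose count is a 2 × 2
determinant of binomials, and the sum over top points telescopes (`card_strictChains_triangle`). The
edge count is the derivative of the polynomial at `1`, evaluated by Vandermonde. -/

/-! ### Counting strict chains in the plane -/

/-- The `k`-element subsets of `s` that are chains for the relation "both coordinates are
strictly smaller". -/
noncomputable def strictChains (s : Finset (ℕ × ℕ)) (k : ℕ) : Finset (Finset (ℕ × ℕ)) :=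
  open scoped Classical in
  (s.powersetCard k).filter fun A => (A : Set (ℕ × ℕ)).Pairwise fun p q =>
    (p.1 < q.1 ∧ p.2 < q.2) ∨ (q.1 < p.1 ∧ q.2 < p.2)

theorem mem_strictChains {s : Finset (ℕ × ℕ)} {k : ℕ} {A : Finset (ℕ × ℕ)} :
    A ∈ strictChains s k ↔ (A ⊆ s ∧ A.card = k) ∧ (A : Set (ℕ × ℕ)).Pairwise fun p q =>
      (p.1 < q.1 ∧ p.2 < q.2) ∨ (q.1 < p.1 ∧ q.2 < p.2) := by
  simp [strictChains, Finset.mem_powersetCard]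

theorem card_strictChains_zero (s : Finset (ℕ × ℕ)) : (strictChains s 0).card = 1 := by
  rw [Finset.card_eq_one]
  refine ⟨∅, Finset.ext fun A => ?_⟩
  rw [mem_strictChains, Finset.mem_singleton, Finset.card_eq_zero]
  constructor
  · exact fun h => h.1.2
  · rintro rfl
    simp

/-- Nonempty chains are counted by their largest element. -/
theorem card_strictChains_succ (s : Finset (ℕ × ℕ)) (k : ℕ) :
    (strictChains s (k + 1)).card =
      ∑ p ∈ s, (strictChains (s.filter fun q => q.1 < p.1 ∧ q.2 < p.2) k).card := by
  rw [← Finset.card_sigma]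
  symm
  refine Finset.card_bij (fun x _ => insert x.1 x.2) ?_ ?_ ?_
  · rintro ⟨p, B⟩ h
    simp only [Finset.mem_sigma, mem_strictChains] at h ⊢
    obtain ⟨hp, ⟨hB, hk⟩, hc⟩ := h
    have hB' : ∀ q ∈ B, q ∈ s ∧ q.1 < p.1 ∧ q.2 < p.2 := fun q hq => by simpa using hB hq
    have hpB : p ∉ B := fun h => absurd (hB' p h).2.1 (lt_irrefl _)
    refine ⟨⟨Finset.insert_subset hp fun q hq => (hB' q hq).1, ?_⟩, ?_⟩
    · rw [Finset.card_insert_of_notMem hpB, hk]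
    · rw [Finset.coe_insert]
      refine hc.insert fun q hq _ => ⟨Or.inr (hB' q hq).2, Or.inl (hB' q hq).2⟩
  · rintro ⟨p, B⟩ h ⟨p', B'⟩ h' heq
    simp only [Finset.mem_sigma, mem_strictChains] at h h' heq
    have hB : ∀ q ∈ B, q.1 < p.1 := fun q hq => (Finset.mem_filter.1 (h.2.1.1 hq)).2.1
    have hB' : ∀ q ∈ B', q.1 < p'.1 := fun q hq => (Finset.mem_filter.1 (h'.2.1.1 hq)).2.1
    have hpp : p = p' := by
      have h1 : p ∈ insert p' B' := heq ▸ Finset.mem_insert_self p B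
      have h2 : p' ∈ insert p B := heq ▸ Finset.mem_insert_self p' B'
      rcases Finset.mem_insert.1 h1 with h1 | h1
      · exact h1
      rcases Finset.mem_insert.1 h2 with h2 | h2
      · exact h2.symm
      exact absurd (hB' _ h1) (not_lt.2 (hB _ h2).le)
    subst hpp
    have h1 : p ∉ B := fun h => lt_irrefl _ (hB _ h)
    have h2 : p ∉ B' := fun h => lt_irrefl _ (hB' _ h)
    rw [← Finset.erase_insert h1, heq, Finset.erase_insert h2]
  · intro A hA
    rw [mem_strictChains] at hA
    obtain ⟨⟨hs, hk⟩, hc⟩ := hA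
    have hne : A.Nonempty := by rw [← Finset.card_pos]; omega
    obtain ⟨p, hp, hmax⟩ := Finset.exists_max_image A Prod.fst hne
    refine ⟨⟨p, A.erase p⟩, ?_, Finset.insert_erase hp⟩
    simp only [Finset.mem_sigma, mem_strictChains]
    refine ⟨hs hp, ⟨fun q hq => ?_, by rw [Finset.card_erase_of_mem hp, hk]; rfl⟩,
      hc.mono (by simp)⟩
    obtain ⟨hqp, hq⟩ := Finset.mem_erase.1 hq
    rcases hc hq hp hqp with h | h
    · exact Finset.mem_filter.2 ⟨hs hq, h⟩
    · exact absurd (hmax q hq) (not_le.2 h.1)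

/-- The lattice points `(i, c)` with `i ≤ c`, `i < a` and `c < b`. -/
def trapezoid (a b : ℕ) : Finset (ℕ × ℕ) :=
  (Finset.range a ×ˢ Finset.range b).filter fun p => p.1 ≤ p.2

theorem mem_trapezoid {a b : ℕ} {p : ℕ × ℕ} :
    p ∈ trapezoid a b ↔ p.1 < a ∧ p.1 ≤ p.2 ∧ p.2 < b := by
  simp [trapezoid]; tauto

/-- The lattice points `(i, c)` with `i ≤ c` and `i + c < m`. -/
def triangle (m : ℕ) : Finset (ℕ × ℕ) :=
  (Finset.range m ×ˢ Finset.range m).filter fun p => p.1 ≤ p.2 ∧ p.1 + p.2 < m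

theorem mem_triangle {m : ℕ} {p : ℕ × ℕ} :
    p ∈ triangle m ↔ p.1 ≤ p.2 ∧ p.1 + p.2 < m := by
  simp [triangle]; omega

/-- By Pascal's rule the sum telescopes; the boundary term at `c = a` vanishes because its two
products coincide. -/
theorem sum_Ico_choose_mul_sub (k a b : ℕ) (h : a ≤ b) :
    ∑ c ∈ Finset.Ico a b, (((a + 1).choose (k + 1) * c.choose k : ℤ) -
        a.choose (k + 1) * (c + 1).choose k) =
      (a + 1).choose (k + 1) * b.choose (k + 1) - a.choose (k + 1) * (b + 1).choose (k + 1) := by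
  induction b, h using Nat.le_induction with
  | base => rw [Finset.Ico_self, Finset.sum_empty]; ring
  | succ b hb ih =>
    rw [Finset.sum_Ico_succ_top hb, ih, Nat.choose_succ_succ' (b + 1) k,
      Nat.choose_succ_succ' b k]
    push_cast
    ring

/-- A determinantal formula for the number of strict chains in a trapezoid. -/
theorem card_strictChains_trapezoid (k a b : ℕ) (h : a ≤ b + 1) :
    ((strictChains (trapezoid a b) k).card : ℤ) =
      (a + 1).choose (k + 1) * b.choose k - a.choose (k + 1) * (b + 1).choose k := by
  induction k generalizing a b with
  | zero => simp [card_strictChains_zero]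
  | succ k ih =>
    -- The points strictly below `p` form the trapezoid with parameters `p.1`, `p.2`, so the
    -- induction hypothesis applies.
    have key : ∀ p ∈ trapezoid a b,
        (((strictChains ((trapezoid a b).filter fun q => q.1 < p.1 ∧ q.2 < p.2) k).card : ℕ) : ℤ) =
          (p.1 + 1).choose (k + 1) * p.2.choose k - p.1.choose (k + 1) * (p.2 + 1).choose k := by
      intro p hp
      rw [mem_trapezoid] at hp
      rw [← ih p.1 p.2 (by omega)]
      congr 3
      ext q
      rw [Finset.mem_filter, mem_trapezoid, mem_trapezoid]
      omega
    rw [card_strictChains_succ, Nat.cast_sum, Finset.sum_congr rfl key,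
      Finset.sum_finset_product _ (Finset.range a) (fun i => Finset.Ico i b)
        (fun p => by rw [mem_trapezoid, Finset.mem_range, Finset.mem_Ico])]
    rw [Finset.sum_congr rfl fun i hi => sum_Ico_choose_mul_sub k i b
      (by rw [Finset.mem_range] at hi; omega)]
    -- The remaining sum over `i` telescopes by Pascal's rule for every `a`, with no bound by `b`.
    clear h key
    induction a with
    | zero => simp [Nat.choose_eq_zero_of_lt (show 1 < k + 1 + 1 by omega)]
    | succ a iha =>
      rw [Finset.sum_range_succ, iha, Nat.choose_succ_succ' (a + 1) (k + 1),
        Nat.choose_succ_succ' a (k + 1)]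
      push_cast
      ring

/-- Each summand is `F (i + 1) - F i` for `F i = i.choose (k + 1) * (2 * n - i + 1).choose (k + 1)`,
and `F 0 = 0`. -/
theorem sum_range_choose_mul_sub (k n j : ℕ) (h : j ≤ n) :
    ∑ i ∈ Finset.range j, (((i + 1).choose (k + 1) * (2 * n - i).choose (k + 1) : ℤ) -
        i.choose (k + 1) * (2 * n - i + 1).choose (k + 1)) =
      j.choose (k + 1) * (2 * n - j + 1).choose (k + 1) := by
  induction j with
  | zero => simp
  | succ j ih =>
    rw [Finset.sum_range_succ, ih (by omega), show 2 * n - (j + 1) + 1 = 2 * n - j by omega]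
    ring

/-- Below a top point `p` the bound on the coordinate sum is automatic, so what remains is a
trapezoid. The first coordinate of `p` runs up to `n - 1`, and the telescoped sum at `j = n` is the
product. -/
theorem card_strictChains_triangle (n k : ℕ) :
    (strictChains (triangle (2 * n)) k).card = n.choose k * (n + 1).choose k := by
  cases k with
  | zero => simp [card_strictChains_zero]
  | succ k =>
    have key : ∀ p ∈ triangle (2 * n),
        (((strictChains ((triangle (2 * n)).filter
            fun q => q.1 < p.1 ∧ q.2 < p.2) k).card : ℕ) : ℤ) =
          (p.1 + 1).choose (k + 1) * p.2.choose k - p.1.choose (k + 1) * (p.2 + 1).choose k := by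
      intro p hp
      rw [mem_triangle] at hp
      rw [← card_strictChains_trapezoid k p.1 p.2 (by omega)]
      congr 3
      ext q
      rw [Finset.mem_filter, mem_triangle, mem_trapezoid]
      omega
    zify
    rw [card_strictChains_succ, Nat.cast_sum, Finset.sum_congr rfl key,
      Finset.sum_finset_product _ (Finset.range n) (fun i => Finset.Ico i (2 * n - i))
        (fun p => by rw [mem_triangle, Finset.mem_range, Finset.mem_Ico]; omega)]
    rw [Finset.sum_congr rfl fun i hi => sum_Ico_choose_mul_sub k i (2 * n - i)
      (by rw [Finset.mem_range] at hi; omega), sum_range_choose_mul_sub k n n le_rfl,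
      show 2 * n - n + 1 = n + 1 by omega]

/-! ### Covering polynomials of lattices of upper ideals -/

section Covering

variable {L : Type*} [PartialOrder L]

/-- The order is reverse inclusion, so `t` is the smaller set. A minimal element of `s \ t` is
minimal in `s`, and erasing it gives a set between the two. -/
theorem UpperSet.covBy_iff_exists_erase [Finite L] {s t : UpperSet L} :
    s ⋖ t ↔ ∃ a, Minimal (· ∈ s) a ∧ s.erase a = t := by
  constructor
  · intro h
    obtain ⟨a, ha⟩ := (Set.toFinite ((s : Set L) \ t)).exists_minimal
      (Set.sdiff_nonempty.2 fun hst => h.1.not_ge hst)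
    refine ⟨a, ⟨ha.1.1, fun b hb hba => ha.2 ⟨hb, fun hbt => ha.1.2 (t.upper hba hbt)⟩ hba⟩, ?_⟩
    refine (h.eq_or_eq UpperSet.le_erase ?_).resolve_left (UpperSet.lt_erase.2 ha.1.1).ne'
    intro b hb
    exact ⟨h.1.le hb, fun hba => ha.1.2 (t.upper hba hb)⟩
  · rintro ⟨a, ha, rfl⟩
    refine ⟨UpperSet.lt_erase.2 ha.1, fun u hsu hu => ?_⟩
    obtain ⟨b, hbu, hb⟩ := Set.not_subset.1 hu.not_ge
    have hbs : b ∈ s := hsu.le hbu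
    have hba : b ≤ a := by
      by_contra hba
      exact hb ⟨hbs, hba⟩
    obtain rfl := ha.eq_of_le hbs hba
    refine hsu.not_ge fun c hc => ?_
    by_cases hcb : c ≤ b
    · rwa [ha.eq_of_le hc hcb]
    · exact hu.le ⟨hc, hcb⟩

theorem LowerSet.covBy_iff_exists_erase [Finite L] {s t : LowerSet L} :
    t ⋖ s ↔ ∃ a, Maximal (· ∈ s) a ∧ s.erase a = t := by
  constructor
  · intro h
    obtain ⟨a, ha⟩ := (Set.toFinite ((s : Set L) \ t)).exists_maximal
      (Set.sdiff_nonempty.2 fun hst => h.1.not_ge hst)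
    refine ⟨a, ⟨ha.1.1, fun b hb hba => ha.2 ⟨hb, fun hbt => ha.1.2 (t.lower hba hbt)⟩ hba⟩, ?_⟩
    refine (h.eq_or_eq ?_ LowerSet.erase_le).resolve_right (LowerSet.erase_lt.2 ha.1.1).ne
    intro b hb
    exact ⟨h.1.le hb, fun hba => ha.1.2 (t.lower hba hb)⟩
  · rintro ⟨a, ha, rfl⟩
    refine ⟨LowerSet.erase_lt.2 ha.1, fun u hu hsu => ?_⟩
    obtain ⟨b, hbu, hb⟩ := Set.not_subset.1 hu.not_ge
    have hbs : b ∈ s := hsu.le hbu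
    have hba : a ≤ b := by
      by_contra hba
      exact hb ⟨hbs, hba⟩
    obtain rfl := ha.eq_of_ge hbs hba
    refine hsu.not_ge fun c hc => ?_
    by_cases hcb : b ≤ c
    · rwa [ha.eq_of_ge hc hcb]
    · exact hu.le ⟨hc, hcb⟩

theorem kappa_upperIdeals [Finite L] (I : UpperIdeals L) :
    kappa I = {a | Minimal (· ∈ OrderDual.ofDual I) a}.ncard := by
  have h : {J : UpperIdeals L | J ⋖ I} = (fun a => OrderDual.toDual ((OrderDual.ofDual I).erase a)) ''
      {a | Minimal (· ∈ OrderDual.ofDual I) a} := by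
    ext J
    rw [Set.mem_ofPred_eq, ← ofDual_covBy_ofDual_iff, UpperSet.covBy_iff_exists_erase]
    rfl
  rw [kappa, h, Set.InjOn.ncard_image]
  intro a ha b hb hab
  by_contra hne
  have hab' : (OrderDual.ofDual I).erase a = (OrderDual.ofDual I).erase b := hab
  have h1 : a ∈ (OrderDual.ofDual I).erase b := ⟨ha.1, fun h => hne (hb.eq_of_le ha.1 h)⟩
  rw [← hab'] at h1
  exact h1.2 le_rfl

/-- On complements, adjoining a maximal non-member becomes erasing a maximal element of a lower set.
-/
theorem iota_upperIdeals [Finite L] (I : UpperIdeals L) :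
    iota I = {a | Maximal (· ∉ OrderDual.ofDual I) a}.ncard := by
  have h : {J : UpperIdeals L | I ⋖ J} =
      (fun a => OrderDual.toDual (((OrderDual.ofDual I).compl).erase a).compl) ''
      {a | Maximal (· ∉ OrderDual.ofDual I) a} := by
    ext J
    rw [Set.mem_ofPred_eq, ← ofDual_covBy_ofDual_iff,
      ← apply_covBy_apply_iff (upperSetIsoLowerSet (α := L))]
    simp only [upperSetIsoLowerSet_apply, LowerSet.covBy_iff_exists_erase, UpperSet.mem_compl_iff]
    refine exists_congr fun a => and_congr_right fun _ => ?_
    constructor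
    · intro h
      change OrderDual.toDual _ = J
      rw [h, UpperSet.compl_compl]
      rfl
    · rintro rfl
      simp
  rw [iota, h, Set.InjOn.ncard_image]
  intro a ha b hb hab
  by_contra hne
  have hb' : Maximal (· ∉ OrderDual.ofDual I) b := hb
  have hab' : (OrderDual.ofDual I).compl.erase a = (OrderDual.ofDual I).compl.erase b :=
    (upperSetIsoLowerSet (α := L)).symm.injective (OrderDual.toDual.injective hab)
  have h1 : a ∈ (OrderDual.ofDual I).compl.erase b := ⟨ha.1, fun h => hne (hb'.eq_of_ge ha.1 h)⟩
  rw [← hab'] at h1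
  exact h1.2 le_rfl

/-- The generating polynomial of the antichains of a finite poset. -/
noncomputable def antichainPolynomial (L : Type*) [PartialOrder L] [Finite L] : ℤ[X] :=
  open scoped Classical in
  letI := Fintype.ofFinite L
  ∑ A ∈ Finset.univ.filter fun A : Finset L => IsAntichain (· ≤ ·) (A : Set L), X ^ A.card

/-- By finiteness an upper ideal is the upper closure of its minimal elements, and every antichain
arises as such a set. -/
theorem upperCoveringPolynomial_upperIdeals [Finite L] :
    upperCoveringPolynomial (UpperIdeals L) = antichainPolynomial L := by
  classical
  let _ := Fintype.ofFinite L
  let _ := Fintype.ofFinite (UpperIdeals L)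
  rw [upperCoveringPolynomial, antichainPolynomial]
  refine Finset.sum_bij'
    (fun I _ => (Set.toFinite {a | Minimal (· ∈ OrderDual.ofDual I) a}).toFinset)
    (fun A _ => OrderDual.toDual (upperClosure (A : Set L))) ?_ ?_ ?_ ?_ ?_
  · intro I _
    simpa using setOfPred_minimal_antichain (· ∈ OrderDual.ofDual I)
  · simp
  · intro I _
    apply OrderDual.ofDual.injective
    ext a
    simp only [OrderDual.ofDual_toDual, Set.Finite.coe_toFinset, SetLike.mem_coe, mem_upperClosure]
    constructor
    · rintro ⟨b, hb, hba⟩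
      exact (OrderDual.ofDual I).upper hba hb.1
    · intro ha
      obtain ⟨b, hba, hb⟩ := exists_minimal_le_of_wellFoundedLT (· ∈ OrderDual.ofDual I) a ha
      exact ⟨b, hb, hba⟩
  · intro A hA
    ext a
    rw [Finset.mem_filter] at hA
    simpa using hA.2.minimal_mem_upperClosure_iff_mem
  · intro I _
    rw [kappa_upperIdeals, Set.ncard_eq_toFinset_card _ (Set.toFinite _)]

/-- The antichain is now that of maximal non-members, whose lower closure is the complement of the
ideal. -/
theorem lowerCoveringPolynomial_upperIdeals [Finite L] :
    lowerCoveringPolynomial (UpperIdeals L) = antichainPolynomial L := by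
  classical
  let _ := Fintype.ofFinite L
  let _ := Fintype.ofFinite (UpperIdeals L)
  rw [lowerCoveringPolynomial, antichainPolynomial]
  refine Finset.sum_bij'
    (fun I _ => (Set.toFinite {a | Maximal (· ∉ OrderDual.ofDual I) a}).toFinset)
    (fun A _ => OrderDual.toDual (lowerClosure (A : Set L)).compl) ?_ ?_ ?_ ?_ ?_
  · intro I _
    simpa using setOfPred_maximal_antichain (· ∉ OrderDual.ofDual I)
  · simp
  · intro I _
    apply OrderDual.ofDual.injective
    ext a
    simp only [OrderDual.ofDual_toDual, Set.Finite.coe_toFinset, SetLike.mem_coe,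
      LowerSet.mem_compl_iff, mem_lowerClosure]
    rw [not_iff_comm]
    constructor
    · intro ha
      obtain ⟨b, hba, hb⟩ := exists_maximal_ge_of_wellFoundedGT (· ∉ OrderDual.ofDual I) a ha
      exact ⟨b, hb, hba⟩
    · rintro ⟨b, hb, hba⟩ ha
      exact hb.1 ((OrderDual.ofDual I).upper hba ha)
  · intro A hA
    ext a
    rw [Finset.mem_filter] at hA
    simpa using hA.2.maximal_mem_lowerClosure_iff_mem
  · intro I _
    rw [iota_upperIdeals, Set.ncard_eq_toFinset_card _ (Set.toFinite _)]

/-- The number of edges of the Hasse diagram is the derivative of the upper covering polynomial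
at `1`. -/
theorem ncard_hasseEdges (P : Type*) [PartialOrder P] [Finite P] :
    ((hasseEdges P).ncard : ℤ) = (derivative (upperCoveringPolynomial P)).eval 1 := by
  classical
  let _ := Fintype.ofFinite P
  have h1 : (derivative (upperCoveringPolynomial P)).eval 1 = ∑ x : P, (kappa x : ℤ) := by
    rw [upperCoveringPolynomial, derivative_sum, eval_finsetSum]
    refine Finset.sum_congr rfl fun x _ => ?_
    simp [derivative_X_pow]
  have h2 : hasseEdges P = (Finset.univ.filter fun e : P × P => e.2 ⋖ e.1 : Finset (P × P)) := by
    ext e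
    simp [hasseEdges]
  rw [h1, h2, Set.ncard_coe_finset, Finset.card_eq_sum_card_fiberwise (f := Prod.fst)
    (t := Finset.univ) (fun _ _ => Finset.mem_univ _), Nat.cast_sum]
  refine Finset.sum_congr rfl fun x _ => ?_
  rw [kappa, Nat.cast_inj, Set.ncard_eq_toFinset_card _ (Set.toFinite _)]
  refine Finset.card_bij (fun e _ => e.2) ?_ ?_ ?_
  · rintro ⟨a, b⟩ h
    simp only [Finset.mem_filter, Finset.mem_univ, true_and] at h
    simpa [← h.2] using h.1
  · rintro ⟨a, b⟩ h ⟨a', b'⟩ h' hb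
    simp only [Finset.mem_filter, Finset.mem_univ, true_and] at h h' hb
    rw [h.2, h'.2, hb]
  · intro b hb
    exact ⟨(x, b), by simpa using hb, rfl⟩

end Covering

/-- The antichain polynomial of a poset isomorphic to a triangle in the plane, in which going up
means decreasing the first or increasing the second coordinate. -/
theorem antichainPolynomial_of_triangle {L : Type*} [PartialOrder L] [Finite L] (n : ℕ)
    (φ : L ≃ {p // p ∈ triangle (2 * n)})
    (hφ : ∀ a b, a ≤ b ↔ (φ b).1.1 ≤ (φ a).1.1 ∧ (φ a).1.2 ≤ (φ b).1.2) :
    antichainPolynomial L =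
      ∑ k ∈ Finset.range (n + 1), C ((n.choose k * (n + 1).choose k : ℕ) : ℤ) * X ^ k := by
  classical
  let _ := Fintype.ofFinite L
  let e : L ↪ ℕ × ℕ := φ.toEmbedding.trans (Function.Embedding.subtype _)
  have he : ∀ a, e a ∈ triangle (2 * n) := fun a => (φ a).2
  -- The order reverses the first coordinate only, so distinct points are incomparable exactly when
  -- both coordinates differ strictly in the same direction.
  have hchain : ∀ A : Finset L, IsAntichain (· ≤ ·) (A : Set L) ↔
      A.map e ∈ strictChains (triangle (2 * n)) A.card := by
    intro A
    rw [mem_strictChains, Finset.card_map, Finset.coe_map,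
      Set.InjOn.pairwise_image e.injective.injOn]
    have hA : A.map e ⊆ triangle (2 * n) := by
      intro p hp
      obtain ⟨a, -, rfl⟩ := Finset.mem_map.1 hp
      exact he a
    simp only [hA, true_and]
    constructor
    · intro h a ha b hb hab
      have h1 := h ha hb hab
      have h2 := h hb ha hab.symm
      simp only [Pi.compl_apply, compl_iff_not, hφ] at h1 h2
      change (_ ∧ _) ∨ (_ ∧ _)
      simp only [e, Function.Embedding.trans_apply, Equiv.coe_toEmbedding,
        Function.Embedding.subtype_apply]
      omega
    · intro h a ha b hb hab hle
      have h1 := h ha hb hab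
      rw [hφ] at hle
      simp only [Function.onFun, e, Function.Embedding.trans_apply, Equiv.coe_toEmbedding,
        Function.Embedding.subtype_apply] at h1
      omega
  have hcount : ∀ k, ((Finset.univ.filter fun A : Finset L =>
      IsAntichain (· ≤ ·) (A : Set L)).filter fun A => A.card = k).card =
      n.choose k * (n + 1).choose k := by
    intro k
    rw [← card_strictChains_triangle]
    refine Finset.card_bij (fun A _ => A.map e) ?_ ?_ ?_
    · intro A hA
      simp only [Finset.mem_filter, Finset.mem_univ, true_and] at hA
      rw [← hA.2]
      exact (hchain A).1 hA.1
    · intro A _ B _ h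
      exact Finset.map_injective e h
    · intro B hB
      have hB' := mem_strictChains.1 hB
      obtain ⟨A, rfl⟩ : ∃ A : Finset L, A.map e = B := by
        refine ⟨Finset.univ.filter fun a => e a ∈ B, ?_⟩
        ext p
        simp only [Finset.mem_map, Finset.mem_filter, Finset.mem_univ, true_and]
        constructor
        · rintro ⟨a, ha, rfl⟩
          exact ha
        · intro hp
          have : e (φ.symm ⟨p, hB'.1.1 hp⟩) = p := by simp [e]
          exact ⟨_, this.symm ▸ hp, this⟩
      have hk : A.card = k := by simpa using hB'.1.2
      refine ⟨A, ?_, rfl⟩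
      simp only [Finset.mem_filter, Finset.mem_univ, true_and]
      exact ⟨(hchain A).2 (hk ▸ hB), hk⟩
  rw [antichainPolynomial, ← Finset.sum_fiberwise_of_maps_to
    (g := Finset.card) (t := Finset.range (n + 1))]
  · refine Finset.sum_congr rfl fun k _ => ?_
    rw [Finset.sum_congr rfl fun A hA => by rw [(Finset.mem_filter.1 hA).2], Finset.sum_const,
      hcount, nsmul_eq_mul]
    simp
  -- An antichain of more than `n` elements would contradict the count, which is then zero.
  · intro A hA
    have h := hcount A.card
    have hpos : 0 < n.choose A.card * (n + 1).choose A.card := by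
      rw [← h]
      exact Finset.card_pos.2 ⟨A, Finset.mem_filter.2 ⟨hA, rfl⟩⟩
    rw [Finset.mem_range, Nat.lt_succ_iff]
    by_contra hlt
    rw [Nat.choose_eq_zero_of_lt (not_le.1 hlt), zero_mul] at hpos
    exact lt_irrefl _ hpos

/-- A weighted form of Vandermonde's identity. -/
theorem sum_mul_choose_mul_choose_succ (n : ℕ) :
    ∑ k ∈ Finset.range (n + 1), n.choose k * (n + 1).choose k * k = n * (2 * n).choose n := by
  cases n with
  | zero => simp
  | succ n =>
    -- After the shift of `k`, absorption turns `(k + 1) * (n + 1).choose (k + 1)` into `(n + 1) *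
    -- n.choose k`, and Vandermonde is applied with the splitting `n + (n + 2)`.
    rw [Finset.sum_range_succ', mul_zero, add_zero, show 2 * (n + 1) = n + (n + 2) by ring,
      Nat.add_choose_eq, Finset.Nat.sum_antidiagonal_eq_sum_range_succ
        (fun i j => n.choose i * (n + 2).choose j), Finset.mul_sum, Finset.sum_range_succ _ (n + 1),
      Nat.choose_eq_zero_of_lt (Nat.lt_succ_self n), zero_mul, mul_zero, add_zero]
    refine Finset.sum_congr rfl fun k hk => ?_
    rw [Finset.mem_range] at hk
    have h1 : (n + 1 + 1).choose (k + 1) = (n + 2).choose (n + 1 - k) := by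
      rw [← Nat.choose_symm (by omega : k + 1 ≤ n + 1 + 1)]
      congr 1
      omega
    rw [h1, mul_right_comm, ← Nat.add_one_mul_choose_eq, mul_assoc]

theorem succ_mul_choose_two_mul_succ (n : ℕ) :
    (n + 1) * (2 * n).choose (n + 1) = n * (2 * n).choose n := by
  have h := Nat.choose_succ_right_eq (2 * n) n
  rw [show 2 * n - n = n by omega] at h
  rw [mul_comm, h, mul_comm]

/-! ### Roots of type `BC n` as differences of an odd sequence -/

section Roots

variable {n : ℕ}

theorem smul_eps_add_smul_eps_mem_rootsBC {a b : Fin n} (hab : a ≠ b) {s t : ℝ}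
    (hs : s = 1 ∨ s = -1) (ht : t = 1 ∨ t = -1) : s • eps a + t • eps b ∈ rootsBC n := by
  refine Or.inl ?_
  rcases lt_or_gt_of_ne hab with h | h
  · refine ⟨a, b, h, ?_⟩
    rcases hs with rfl | rfl <;> rcases ht with rfl | rfl <;>
      simp only [one_smul, neg_smul, ← sub_eq_add_neg, true_or, or_true]
  · refine ⟨b, a, h, ?_⟩
    rw [add_comm]
    rcases hs with rfl | rfl <;> rcases ht with rfl | rfl <;>
      simp only [one_smul, neg_smul, ← sub_eq_add_neg, true_or, or_true]

theorem smul_eps_mem_rootsBC (a : Fin n) {s : ℝ} (hs : s = 1 ∨ s = -1) :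
    s • eps a ∈ rootsBC n :=
  Or.inr (Or.inl ⟨a, by rcases hs with rfl | rfl <;> simp only [one_smul, neg_smul, true_or, or_true]⟩)

theorem smul_eps_add_self_mem_rootsBC (a : Fin n) {s : ℝ} (hs : s = 1 ∨ s = -1) :
    s • eps a + s • eps a ∈ rootsBC n :=
  Or.inr (Or.inr ⟨a, by
    rcases hs with rfl | rfl <;>
      simp only [one_smul, neg_smul, two_smul, neg_add, true_or, or_true]⟩)

/-- Every root is a sum of two vectors `± ε i`, or a single one. -/
theorem exists_smul_eps_of_mem_rootsBC {v : EuclideanSpace ℝ (Fin n)} (hv : v ∈ rootsBC n) :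
    ∃ (a : Fin n) (s : ℝ), (s = 1 ∨ s = -1) ∧ (v = s • eps a ∨
      ∃ (b : Fin n) (t : ℝ), (t = 1 ∨ t = -1) ∧ v = s • eps a + t • eps b) := by
  have e1 : (1 : ℝ) = 1 ∨ (1 : ℝ) = -1 := Or.inl rfl
  have e2 : (-1 : ℝ) = 1 ∨ (-1 : ℝ) = -1 := Or.inr rfl
  rcases hv with ⟨i, j, -, h | h | h | h⟩ | ⟨i, h | h⟩ | ⟨i, h | h⟩
  · exact ⟨i, 1, e1, Or.inr ⟨j, 1, e1, by rw [h]; module⟩⟩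
  · exact ⟨i, 1, e1, Or.inr ⟨j, -1, e2, by rw [h]; module⟩⟩
  · exact ⟨i, -1, e2, Or.inr ⟨j, 1, e1, by rw [h]; module⟩⟩
  · exact ⟨i, -1, e2, Or.inr ⟨j, -1, e2, by rw [h]; module⟩⟩
  · exact ⟨i, 1, e1, Or.inl (by rw [h]; module)⟩
  · exact ⟨i, -1, e2, Or.inl (by rw [h]; module)⟩
  · exact ⟨i, 1, e1, Or.inr ⟨i, 1, e1, by rw [h]; module⟩⟩
  · exact ⟨i, -1, e2, Or.inr ⟨i, -1, e2, by rw [h]; module⟩⟩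

theorem ne_zero_of_mem_rootsBC {v : EuclideanSpace ℝ (Fin n)} (hv : v ∈ rootsBC n) : v ≠ 0 := by
  rintro rfl
  rcases hv with ⟨i, j, hij, h⟩ | ⟨i, h⟩ | ⟨i, h⟩
  · rcases h with h | h | h | h <;>
      · have := congrArg (fun v : EuclideanSpace ℝ (Fin n) => v i) h
        simp [hij.ne] at this
  · rcases h with h | h <;>
      · have := congrArg (fun v : EuclideanSpace ℝ (Fin n) => v i) h
        simp at this
  · rcases h with h | h <;>
      · have := congrArg (fun v : EuclideanSpace ℝ (Fin n) => v i) h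
        simp at this

/-- A linear form without zeros on the roots singles out a signed permutation of the standard
basis on which it is positive and decreasing. -/
theorem exists_signed_perm (f : EuclideanSpace ℝ (Fin n) →ₗ[ℝ] ℝ)
    (hf : ∀ γ ∈ rootsBC n, f γ ≠ 0) :
    ∃ (σ : Equiv.Perm (Fin n)) (s : Fin n → ℝ), (∀ i, s i = 1 ∨ s i = -1) ∧
      (∀ i, 0 < f (s i • eps (σ i))) ∧
      ∀ i j, i < j → f (s j • eps (σ j)) < f (s i • eps (σ i)) := by
  let y : Fin n → ℝ := fun i => f (eps i)
  have e1 : (1 : ℝ) = 1 ∨ (1 : ℝ) = -1 := Or.inl rfl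
  have e2 : (-1 : ℝ) = 1 ∨ (-1 : ℝ) = -1 := Or.inr rfl
  have hy0 : ∀ i, y i ≠ 0 := fun i => by
    simpa using hf _ (smul_eps_mem_rootsBC i e1)
  have hy : ∀ i j, i ≠ j → |y i| ≠ |y j| := by
    intro i j hij h
    rcases abs_eq_abs.1 h with h | h
    · refine hf _ (smul_eps_add_smul_eps_mem_rootsBC hij e1 e2) ?_
      rw [map_add, map_smul, map_smul]
      change 1 * y i + -1 * y j = 0
      rw [h]; ring
    · refine hf _ (smul_eps_add_smul_eps_mem_rootsBC hij e1 e1) ?_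
      rw [map_add, map_smul, map_smul]
      change 1 * y i + 1 * y j = 0
      rw [h]; ring
  -- Sorting by `-|y i|` makes the absolute values decrease, strictly because `f` vanishes on no `ε
  -- i ± ε j`.
  let σ := Tuple.sort fun i => -|y i|
  have hfs : ∀ i, f ((if 0 < y (σ i) then (1 : ℝ) else -1) • eps (σ i)) = |y (σ i)| := by
    intro i
    rw [map_smul]
    change _ * y (σ i) = _
    split_ifs with h
    · rw [one_mul, abs_of_pos h]
    · rw [abs_of_nonpos (not_lt.1 h)]; ring
  refine ⟨σ, fun i => if 0 < y (σ i) then 1 else -1, fun i => ?_, fun i => ?_, fun i j hij => ?_⟩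
  · dsimp only
    split_ifs <;> simp
  · rw [hfs]
    exact abs_pos.2 (hy0 _)
  · rw [hfs, hfs]
    have h := Tuple.monotone_sort (fun i => -|y i|) hij.le
    simp only [Function.comp_apply, neg_le_neg_iff] at h
    exact lt_of_le_of_ne h (hy _ _ (σ.injective.ne hij.ne'))

/-- The roots are the differences of the terms of a sequence `E 0, …, E (2 n)` that is
odd about `n` and along which a given linear form decreases. -/
theorem exists_odd_sequence (f : EuclideanSpace ℝ (Fin n) →ₗ[ℝ] ℝ)
    (hf : ∀ γ ∈ rootsBC n, f γ ≠ 0) :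
    ∃ E : ℕ → EuclideanSpace ℝ (Fin n),
      (∀ c ≤ 2 * n, E (2 * n - c) = -E c) ∧
      (∀ x y, x < y → y ≤ 2 * n → f (E y) < f (E x)) ∧
      (∀ x y, x < y → y ≤ 2 * n → E x - E y ∈ rootsBC n) ∧
      (∀ γ ∈ rootsBC n, ∃ x y, x ≤ 2 * n ∧ y ≤ 2 * n ∧ γ = E x - E y) ∧
      (∀ m < n, ∃ ω : EuclideanSpace ℝ (Fin n) →ₗ[ℝ] ℝ, ∀ c ≤ 2 * n,
        ω (E c) = (if c ≤ m then 1 else 0) - (if 2 * n ≤ c + m then 1 else 0)) := by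
  obtain ⟨σ, s, hs, hpos, hanti⟩ := exists_signed_perm f hf
  let e : Fin n → EuclideanSpace ℝ (Fin n) := fun i => s i • eps (σ i)
  have hneg : ∀ i, -s i = 1 ∨ -s i = -1 := fun i => by
    rcases hs i with h | h <;> simp [h]
  -- The middle term `0` yields the short roots `e i`; the mirrored pair `i`, `2n - i` yields `2 e
  -- i`.
  let E : ℕ → EuclideanSpace ℝ (Fin n) := fun c =>
    if h : c < n then e ⟨c, h⟩ else if h : n < c ∧ c ≤ 2 * n then -e ⟨2 * n - c, by omega⟩ else 0
  have hE1 : ∀ i : Fin n, E i = e i := fun i => by simp [E]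
  have hE0 : E n = 0 := by simp [E]
  have hE2 : ∀ i : Fin n, E (2 * n - i) = -e i := fun i => by
    have h1 : ¬ (2 * n - (i : ℕ) < n) := by omega
    have h2 : n < 2 * n - (i : ℕ) ∧ 2 * n - (i : ℕ) ≤ 2 * n := by omega
    simp only [E, dif_neg h1, dif_pos h2]
    congr 2
    ext
    simp only
    omega
  have hcases : ∀ c ≤ 2 * n, (∃ i : Fin n, c = i) ∨ c = n ∨ ∃ i : Fin n, c = 2 * n - i := by
    intro c hc
    rcases lt_trichotomy c n with h | h | h
    · exact Or.inl ⟨⟨c, h⟩, rfl⟩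
    · exact Or.inr (Or.inl h)
    · exact Or.inr (Or.inr ⟨⟨2 * n - c, by omega⟩, by simp only; omega⟩)
  have hodd : ∀ c ≤ 2 * n, E (2 * n - c) = -E c := by
    intro c hc
    rcases hcases c hc with ⟨i, rfl⟩ | rfl | ⟨i, rfl⟩
    · rw [hE1, hE2]
    · rw [show 2 * c - c = c by omega, hE0, neg_zero]
    · rw [hE2, neg_neg, show 2 * n - (2 * n - (i : ℕ)) = i by omega, hE1]
  have hsum : ∀ i j, e i + e j ∈ rootsBC n := by
    intro i j
    by_cases hij : i = j
    · subst hij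
      exact smul_eps_add_self_mem_rootsBC _ (hs i)
    · exact smul_eps_add_smul_eps_mem_rootsBC (σ.injective.ne hij) (hs i) (hs j)
  have hdiff : ∀ i j, i ≠ j → e i - e j ∈ rootsBC n := by
    intro i j hij
    have := smul_eps_add_smul_eps_mem_rootsBC (σ.injective.ne hij) (hs i) (hneg j)
    rwa [neg_smul, ← sub_eq_add_neg] at this
  refine ⟨E, hodd, ?_, ?_, ?_, ?_⟩
  · intro x y hxy hy
    have hp : ∀ i, 0 < f (e i) := hpos
    rcases hcases x (by omega) with ⟨i, rfl⟩ | rfl | ⟨i, rfl⟩ <;>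
      rcases hcases y hy with ⟨j, rfl⟩ | rfl | ⟨j, rfl⟩
    · rw [hE1, hE1]
      exact hanti i j hxy
    · rw [hE1, hE0, map_zero]
      exact hp i
    · rw [hE1, hE2, map_neg]
      linarith [hp i, hp j]
    · omega
    · omega
    · rw [hE0, hE2, map_neg, map_zero]
      linarith [hp j]
    · omega
    · omega
    · rw [hE2, hE2, map_neg, map_neg]
      have : f (e i) < f (e j) := hanti j i (by rw [Fin.lt_def]; omega)
      linarith
  · intro x y hxy hy
    rcases hcases x (by omega) with ⟨i, rfl⟩ | rfl | ⟨i, rfl⟩ <;>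
      rcases hcases y hy with ⟨j, rfl⟩ | rfl | ⟨j, rfl⟩
    · rw [hE1, hE1]
      exact hdiff i j (by rintro rfl; omega)
    · rw [hE1, hE0, sub_zero]
      exact smul_eps_mem_rootsBC _ (hs i)
    · rw [hE1, hE2, sub_neg_eq_add]
      exact hsum i j
    · omega
    · omega
    · rw [hE0, hE2, sub_neg_eq_add, zero_add]
      exact smul_eps_mem_rootsBC _ (hs j)
    · omega
    · omega
    · rw [hE2, hE2, sub_neg_eq_add, neg_add_eq_sub]
      exact hdiff j i (by rintro rfl; omega)
  · have hmem : ∀ (a : Fin n) (t : ℝ), (t = 1 ∨ t = -1) → ∃ x ≤ 2 * n, t • eps a = E x := by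
      intro a t ht
      have hsa : s (σ.symm a) = t ∨ s (σ.symm a) = -t := by
        rcases hs (σ.symm a) with h | h <;> rcases ht with rfl | rfl <;> simp [h]
      have hea : e (σ.symm a) = s (σ.symm a) • eps a := by simp [e]
      rcases hsa with h | h
      · exact ⟨σ.symm a, by omega, by rw [hE1, hea, h]⟩
      · exact ⟨2 * n - σ.symm a, by omega, by rw [hE2, hea, h, neg_smul, neg_neg]⟩
    intro γ hγ
    obtain ⟨a, s, hs, h | ⟨b, t, ht, h⟩⟩ := exists_smul_eps_of_mem_rootsBC hγ
    · obtain ⟨x, hx, hxE⟩ := hmem a s hs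
      exact ⟨x, n, hx, by omega, by rw [h, hxE, hE0, sub_zero]⟩
    · obtain ⟨x, hx, hxE⟩ := hmem a s hs
      obtain ⟨y, hy, hyE⟩ := hmem b t ht
      exact ⟨x, 2 * n - y, hx, by omega, by rw [h, hxE, hyE, hodd y hy, sub_neg_eq_add]⟩
  · intro m hm
    -- The sum of the first `m + 1` signed coordinates: a fundamental coweight, equal to `1` on `E m
    -- - E (m + 1)` and `0` on the other `E k - E (k + 1)` with `k < n`.
    let ω : EuclideanSpace ℝ (Fin n) →ₗ[ℝ] ℝ :=
      ∑ l ∈ Finset.univ.filter fun l : Fin n => (l : ℕ) ≤ m,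
        s l • (EuclideanSpace.proj (𝕜 := ℝ) (σ l)).toLinearMap
    have hω : ∀ i : Fin n, ω (e i) = if (i : ℕ) ≤ m then 1 else 0 := by
      intro i
      have hsq : s i * s i = 1 := by rcases hs i with h | h <;> simp [h]
      simp only [ω, e, LinearMap.sum_apply, LinearMap.smul_apply]
      have hterm : ∀ l : Fin n, s l • (EuclideanSpace.proj (𝕜 := ℝ) (σ l)).toLinearMap
          (s i • eps (σ i)) = if i = l then 1 else 0 := by
        intro l
        by_cases h : i = l
        · subst h
          simp [hsq]
        · simp [h, σ.injective.ne (Ne.symm h)]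
      rw [Finset.sum_congr rfl fun l _ => hterm l, Finset.sum_ite_eq]
      simp
    refine ⟨ω, fun c hc => ?_⟩
    rcases hcases c hc with ⟨i, rfl⟩ | rfl | ⟨i, rfl⟩
    · rw [hE1, hω, if_neg (show ¬ 2 * n ≤ (i : ℕ) + m by omega), sub_zero]
    · rw [hE0, map_zero, if_neg (by omega), if_neg (by omega), sub_zero]
    · rw [hE2, map_neg, hω, if_neg (show ¬ 2 * n - (i : ℕ) ≤ m by omega), zero_sub]
      congr 1
      exact if_congr (by omega) rfl rfl

end Roots

/-! ### The poset of positive roots of type `BC n` -/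

section PositiveRoots

variable {n : ℕ}

theorem AddSubmonoid.eq_zero_or_one_le_of_mem_closure {V : Type*} [AddCommGroup V] [Module ℝ V]
    {s : Set V} (f : V →ₗ[ℝ] ℝ) (hf : ∀ a ∈ s, f a = 1) {v : V}
    (hv : v ∈ AddSubmonoid.closure s) : v = 0 ∨ 1 ≤ f v := by
  induction hv using AddSubmonoid.closure_induction with
  | mem x hx => exact Or.inr (hf x hx).ge
  | zero => exact Or.inl rfl
  | add x y _ _ hx hy =>
    rcases hx with rfl | hx
    · simpa using hy
    · right
      rw [map_add]
      rcases hy with rfl | hy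
      · simpa using hx
      · linarith

theorem span_simple_eq_top (S : SimpleSystem (rootsBC n)) :
    Submodule.span ℝ S.simple = ⊤ := by
  have hcl : AddSubmonoid.closure S.simple ≤ (Submodule.span ℝ S.simple).toAddSubmonoid :=
    (AddSubmonoid.closure_le).2 Submodule.subset_span
  have heps : ∀ i, eps i ∈ Submodule.span ℝ S.simple := by
    intro i
    have hi : eps i ∈ rootsBC n := by
      simpa using smul_eps_mem_rootsBC i (s := 1) (Or.inl rfl)
    rcases S.mem_or_neg_mem _ hi with h | h
    · exact hcl h
    · exact (Submodule.neg_mem_iff _).1 (hcl h)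
  rw [eq_top_iff, ← (EuclideanSpace.basisFun (Fin n) ℝ).toBasis.span_eq, Submodule.span_le]
  rintro _ ⟨i, rfl⟩
  simpa using heps i

/-- The positive roots are the points of a triangle, in which going up means decreasing the first
or increasing the second coordinate. -/
theorem exists_posRoot_equiv_triangle (S : SimpleSystem (rootsBC n)) :
    ∃ φ : PosRoot S ≃ {p // p ∈ triangle (2 * n)},
      ∀ a b, a ≤ b ↔ (φ b).1.1 ≤ (φ a).1.1 ∧ (φ a).1.2 ≤ (φ b).1.2 := by
  obtain ⟨f, hf⟩ := PosRoot.exists_height S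
  have hcl : ∀ v ∈ AddSubmonoid.closure S.simple, v = 0 ∨ 1 ≤ f v :=
    fun v hv => AddSubmonoid.eq_zero_or_one_le_of_mem_closure f hf hv
  have hroot : ∀ γ ∈ rootsBC n, 1 ≤ |f γ| := by
    intro γ hγ
    rcases S.mem_or_neg_mem γ hγ with h | h
    · exact ((hcl _ h).resolve_left (ne_zero_of_mem_rootsBC hγ)).trans (le_abs_self _)
    · have := (hcl _ h).resolve_left (neg_ne_zero.2 (ne_zero_of_mem_rootsBC hγ))
      rw [map_neg] at this
      exact this.trans (neg_le_abs _)
  obtain ⟨E, hodd, hanti, hmem, hsurj, hω⟩ := exists_odd_sequence f fun γ hγ h => by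
    have := hroot γ hγ
    rw [h, abs_zero] at this
    linarith
  have hpos : ∀ x y, x < y → y ≤ 2 * n →
      E x - E y ∈ AddSubmonoid.closure S.simple ∧ 1 ≤ f (E x - E y) := by
    intro x y hxy hy
    have h0 : 0 < f (E x - E y) := by rw [map_sub]; linarith [hanti x y hxy hy]
    have h1 := hroot _ (hmem x y hxy hy)
    rw [abs_of_pos h0] at h1
    refine ⟨(S.mem_or_neg_mem _ (hmem x y hxy hy)).resolve_right fun h => ?_, h1⟩
    rcases hcl _ h with h | h
    · rw [neg_eq_zero.1 h, map_zero] at h0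
      exact lt_irrefl _ h0
    · rw [map_neg] at h
      linarith
  -- Positivity forces `x < y`; if `x + y` exceeds `2n`, the pair `(2n - y, 2n - x)` represents the
  -- same root.
  have hcanon : ∀ γ ∈ rootsBC n, 0 < f γ → ∃ x y, x < y ∧ x + y ≤ 2 * n ∧ γ = E x - E y := by
    intro γ hγ h0
    obtain ⟨x, y, hx, hy, rfl⟩ := hsurj γ hγ
    have hxy : x < y := by
      by_contra h
      rcases eq_or_lt_of_le (not_lt.1 h) with h | h
      · subst h
        simp at h0
      · rw [map_sub] at h0
        linarith [hanti y x h hx]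
    rcases le_or_gt (x + y) (2 * n) with h | h
    · exact ⟨x, y, hxy, h, rfl⟩
    · refine ⟨2 * n - y, 2 * n - x, by omega, by omega, ?_⟩
      rw [hodd x hx, hodd y hy]
      abel
  -- A non-consecutive difference splits into two positive roots of height at least `1`, whereas a
  -- simple root has height `1`.
  have hsub : S.simple ⊆ Set.range fun k : Fin n => E k - E (k + 1) := by
    intro α hα
    obtain ⟨x, y, hxy, h, rfl⟩ := hcanon α (S.simple_subset hα) (by rw [hf α hα]; exact one_pos)
    rcases eq_or_lt_of_le (Nat.succ_le_of_lt hxy) with hy | hy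
    · subst hy
      exact ⟨⟨x, by omega⟩, rfl⟩
    · have h1 := (hpos x (x + 1) (by omega) (by omega)).2
      have h2 := (hpos (x + 1) y hy (by omega)).2
      have h3 := hf _ hα
      rw [map_sub] at h1 h2 h3
      linarith
  -- Equality by counting: there are at most `n` such differences, while the simple roots span a
  -- space of dimension `n`.
  have hsimple : S.simple = Set.range fun k : Fin n => E k - E (k + 1) := by
    refine Set.eq_of_subset_of_ncard_le hsub ?_ (Set.finite_range _)
    have hfin : S.simple.Finite := (Set.finite_range _).subset hsub
    have h1 : (Set.range fun k : Fin n => E k - E (k + 1)).ncard ≤ n := by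
      rw [← Set.image_univ]
      refine (Set.ncard_image_le Set.finite_univ).trans ?_
      simp [Set.ncard_univ]
    have h2 : n ≤ S.simple.ncard := by
      let _ := hfin.fintype
      have h := finrank_span_le_card (R := ℝ) S.simple
      rw [span_simple_eq_top, finrank_top, finrank_euclideanSpace_fin] at h
      rwa [Set.ncard_eq_toFinset_card']
    exact h1.trans h2
  have hsimple_mem : ∀ k < n, E k - E (k + 1) ∈ S.simple := fun k hk => by
    rw [hsimple]
    exact ⟨⟨k, hk⟩, rfl⟩
  let R : ∀ x y, x < y ∧ x + y ≤ 2 * n → PosRoot S := fun x y h =>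
    ⟨E x - E y, hmem x y h.1 (by omega), (hpos x y h.1 (by omega)).1⟩
  have hup1 : ∀ d x y h h', R (x + d) y h ≤ R x y h' := by
    intro d
    induction d with
    | zero => exact fun x y _ _ => le_rfl
    | succ d ih =>
      intro x y h h'
      refine le_trans (b := R (x + d) y (by omega)) (Relation.ReflTransGen.single ?_)
        (ih x y (by omega) h')
      change (E (x + d) - E y) - (E (x + (d + 1)) - E y) ∈ S.simple
      rw [sub_sub_sub_cancel_right]
      exact hsimple_mem (x + d) (by omega)
  have hup2 : ∀ d x y h h', R x y h ≤ R x (y + d) h' := by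
    intro d
    induction d with
    | zero => exact fun x y _ _ => le_rfl
    | succ d ih =>
      intro x y h h'
      refine le_trans (b := R x (y + d) (by omega)) (ih x y h (by omega))
        (Relation.ReflTransGen.single ?_)
      change (E x - E (y + (d + 1))) - (E x - E (y + d)) ∈ S.simple
      rw [sub_sub_sub_cancel_left]
      -- Past the midpoint, oddness reflects the step to the consecutive difference starting at
      -- index `2n - (y + d + 1)`.
      rcases lt_or_ge (y + d) n with hlt | hge
      · exact hsimple_mem (y + d) hlt
      · have := hsimple_mem (2 * n - (y + (d + 1))) (by omega)
        rw [show 2 * n - (y + (d + 1)) + 1 = 2 * n - (y + d) by omega, hodd _ (by omega),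
          hodd _ (by omega)] at this
        rwa [neg_sub_neg] at this
  have hmono : ∀ ω : EuclideanSpace ℝ (Fin n) →ₗ[ℝ] ℝ, (∀ a ∈ S.simple, 0 ≤ ω a) →
      ∀ a b : PosRoot S, a ≤ b → ω a.1 ≤ ω b.1 := by
    intro ω h0 a b hab
    induction (show Relation.ReflTransGen PosRoot.Step a b from hab) with
    | refl => exact le_rfl
    | tail _ h ih =>
      have := h0 _ h
      rw [map_sub] at this
      linarith [ih ‹_›]
  have hle : ∀ x y h x' y' h', R x y h ≤ R x' y' h' ↔ x' ≤ x ∧ y ≤ y' := by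
    intro x y h x' y' h'
    constructor
    · intro hab
      -- Comparison of the coefficients of the simple root `E m - E (m + 1)`.
      have key : ∀ m < n,
          ((if x ≤ m then 1 else 0) - (if y ≤ m then 1 else 0) +
              (if 2 * n ≤ y + m then 1 else 0) : ℤ) ≤
            (if x' ≤ m then 1 else 0) - (if y' ≤ m then 1 else 0) +
              (if 2 * n ≤ y' + m then 1 else 0) := by
        intro m hm
        obtain ⟨ω, hωE⟩ := hω m hm
        have h1 := hmono ω (fun a ha => by
          rw [hsimple] at ha
          obtain ⟨k, rfl⟩ := ha
          change 0 ≤ ω (E k - E (k + 1))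
          rw [map_sub, hωE _ (by omega), hωE _ (by omega),
            if_neg (show ¬ 2 * n ≤ (k : ℕ) + m by omega)]
          split_ifs <;> first | omega | norm_num) _ _ hab
        change ω (E x - E y) ≤ ω (E x' - E y') at h1
        rw [map_sub, map_sub, hωE _ (by omega), hωE _ (by omega), hωE _ (by omega),
          hωE _ (by omega), if_neg (show ¬ 2 * n ≤ x + m by omega),
          if_neg (show ¬ 2 * n ≤ x' + m by omega), sub_zero, sub_zero, sub_sub_eq_add_sub,
          sub_sub_eq_add_sub, add_sub_right_comm, add_sub_right_comm] at h1
        exact_mod_cast h1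
      -- At `m = x` the left coefficient is positive, which forces `x' ≤ x`. For `y ≤ n`, at `m = y
      -- - 1` it is `1`, but the right one would be `0` if `y' < y`. For `y > n`, at `m = 2n - y` it
      -- is `2`, which forces `y ≤ y'`.
      have hx := key x (by omega)
      refine ⟨by split_ifs at hx <;> omega, ?_⟩
      rcases le_or_gt y n with hyn | hyn
      · have hy := key (y - 1) (by omega)
        split_ifs at hy <;> omega
      · have hy := key (2 * n - y) (by omega)
        split_ifs at hy <;> omega
    · rintro ⟨hx, hy⟩
      obtain ⟨d, rfl⟩ := Nat.exists_eq_add_of_le hx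
      obtain ⟨d', rfl⟩ := Nat.exists_eq_add_of_le hy
      exact (hup1 d x' y h (by omega)).trans (hup2 d' x' y (by omega) h')
  have htri : ∀ p : {p // p ∈ triangle (2 * n)}, p.1.1 < p.1.2 + 1 ∧ p.1.1 + (p.1.2 + 1) ≤ 2 * n :=
    fun p => by
      have := mem_triangle.1 p.2
      omega
  -- Shifting `y` by one turns `x < y`, `x + y ≤ 2n` into the inequalities of the triangle.
  let ψ : {p // p ∈ triangle (2 * n)} → PosRoot S := fun p => R p.1.1 (p.1.2 + 1) (htri p)
  have hψ : ∀ p q, ψ p ≤ ψ q ↔ q.1.1 ≤ p.1.1 ∧ p.1.2 ≤ q.1.2 := fun p q => by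
    rw [hle _ _ (htri p) _ _ (htri q), Nat.add_le_add_iff_right]
  have hbij : Function.Bijective ψ := by
    constructor
    · intro p q h
      have h1 := (hψ p q).1 h.le
      have h2 := (hψ q p).1 h.ge
      exact Subtype.ext (Prod.ext (by omega) (by omega))
    · rintro ⟨γ, hγ, hγc⟩
      obtain ⟨x, y, hxy, h, rfl⟩ := hcanon γ hγ (by
        have := (hcl _ hγc).resolve_left (ne_zero_of_mem_rootsBC hγ)
        linarith)
      refine ⟨⟨(x, y - 1), mem_triangle.2 (by simp only; omega)⟩, Subtype.ext ?_⟩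
      change E x - E (y - 1 + 1) = _
      rw [Nat.sub_add_cancel (by omega)]
  refine ⟨(Equiv.ofBijective ψ hbij).symm, fun a b => ?_⟩
  rw [← hψ]
  simp only [← Equiv.ofBijective_apply ψ hbij, Equiv.apply_symm_apply]

end PositiveRoots

theorem proposition3p1 (n : ℕ) (S : SimpleSystem (rootsBC n)) :
    upperCoveringPolynomial (UpperIdeals (PosRoot S)) =
        ∑ k ∈ Finset.range (n + 1), C ((n.choose k * (n + 1).choose k : ℕ) : ℤ) * X ^ k ∧
      lowerCoveringPolynomial (UpperIdeals (PosRoot S)) =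
        ∑ k ∈ Finset.range (n + 1), C ((n.choose k * (n + 1).choose k : ℕ) : ℤ) * X ^ k ∧
      (hasseEdges (UpperIdeals (PosRoot S))).ncard = (n + 1) * (2 * n).choose (n + 1) ∧
      (hasseEdges (UpperIdeals (PosRoot S))).ncard = n * (2 * n).choose n := by
  obtain ⟨φ, hφ⟩ := exists_posRoot_equiv_triangle S
  have hpoly := antichainPolynomial_of_triangle n φ hφ
  have hupper := upperCoveringPolynomial_upperIdeals (L := PosRoot S) |>.trans hpoly
  have hedges : (hasseEdges (UpperIdeals (PosRoot S))).ncard = n * (2 * n).choose n := by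
    rw [← sum_mul_choose_mul_choose_succ, ← Nat.cast_inj (R := ℤ), ncard_hasseEdges, hupper,
      derivative_sum, eval_finsetSum, Nat.cast_sum]
    refine Finset.sum_congr rfl fun k _ => ?_
    simp [derivative_X_pow]
  exact ⟨hupper, lowerCoveringPolynomial_upperIdeals.trans hpoly,
    by rw [hedges, succ_mul_choose_two_mul_succ], hedges⟩
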